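/- Let $\Omega_0$ be the set of continuous functions $\omega:\mathbb{R}\to\mathbb{R}$ with $\omega(0)=0$, let $\mathcal{B}_{\Omega_0}$ be the Borel $\sigma$-field of the topology of locally uniform convergence on $\Omega_0$, and let $\mathsf{W}$ be the two-sided Wiener measure on it, i.e. the probability measure under which $(\omega(t))_{t\ge 0}$ and $(\omega(-t))_{t\ge 0}$ are independent standard Brownian motions; let $\mathcal{G}$ be the $\mathsf{W}$-completion of $\mathcal{B}_{\Omega_0}$, to which $\mathsf{W}$ is extended. For $u\in\mathbb{R}$ let $\Delta_u:\Omega_0\to\Omega_0$, $\Delta_u(\omega)(t)=\omega(u+t)-\omega(u)$, be the Lévy shift. Let $\mathbb{R}^\dagger=\mathbb{R}\cup\{\dagger\}$ with $\dagger\notin\mathbb{R}$, equipped with the $\sigma$-field generated by the Borel sets of $\mathbb{R}$ and $\{\dagger\}$. A map $M:\Omega_0\to 2^{\mathbb{R}}$ is called a random countable set if there is a sequence $(S_i)_{i\in\mathbb{N}}$ of $\mathcal{G}$-measurable maps $S_i:\Omega_0\to\mathbb{R}^\dagger$ such that, for $\mathsf{W}$-almost every $\omega$, $M(\omega)=\{S_i(\omega):i\in\mathbb{N}\}\setminus\{\dagger\}$.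 It is called stationary if for every $u\in\mathbb{R}$ one has $M(\omega)=u+M(\Delta_u\omega)$ for $\mathsf{W}$-almost every $\omega$, and perfectly stationary if $M(\omega)=u+M(\Delta_u\omega)$ for all $u\in\mathbb{R}$ and all $\omega\in\Omega_0$. A map $M':\Omega_0\to 2^{\mathbb{R}}$ is called a version of $M$ if $\{M=M'\}\in\mathcal{G}$ and $\mathsf{W}(M=M')=1$. **Proposition.** Every stationary random countable set $M$ admits a version $M'$ which is a perfectly stationary random countable set, for which $M'(\omega)$ is countable for every $\omega\in\Omega_0$, and for which $$\{(\omega,t)\in\Omega_0\times\mathbb{R}: t\in M'(\omega)\}\in\mathcal{B}_{\Omega_0}\otimes\mathcal{B}_{\mathbb{R}}.$$ -/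

import Mathlib

open MeasureTheory ProbabilityTheory
open scoped NNReal

/-- The two-sided path space `Ω₀`: the continuous functions `ω : ℝ → ℝ` with `ω 0 = 0`. -/
def PathSpace : Type := {ω : C(ℝ, ℝ) // ω 0 = 0}

namespace PathSpace

instance : CoeFun PathSpace (fun _ => ℝ → ℝ) := ⟨fun ω t => ω.1 t⟩

/-- The topology of locally uniform convergence (the compact-open topology). -/
instance : TopologicalSpace PathSpace :=
  inferInstanceAs (TopologicalSpace {ω : C(ℝ, ℝ) // ω 0 = 0})

/-- The Borel `σ`-field of the topology of locally uniform convergence. -/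
instance : MeasurableSpace PathSpace := borel PathSpace

instance : BorelSpace PathSpace := ⟨rfl⟩

/-- The Lévy shift `Δ_u ω = ω (u + ·) - ω u`. -/
def levyShift (u : ℝ) (ω : PathSpace) : PathSpace :=
  ⟨⟨fun t => ω (u + t) - ω u,
    (ω.1.continuous.comp (continuous_const.add continuous_id)).sub continuous_const⟩, by simp⟩

end PathSpace

/-- `W` is the two-sided Wiener measure on the Borel `σ`-field of `PathSpace`: under `W` the
processes `(ω t)_{t ≥ 0}` and `(ω (-t))_{t ≥ 0}` are independent standard Brownian motions. This
determines `W` uniquely. The completion of `W` enters below through `NullMeasurable`,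
`NullMeasurableSet` and almost-everywhere quantifiers. -/
structure IsTwoSidedWienerMeasure (W : Measure PathSpace) : Prop where
  forward : IsBrownianReal (fun (t : ℝ≥0) (ω : PathSpace) => ω (t : ℝ)) W
  backward : IsBrownianReal (fun (t : ℝ≥0) (ω : PathSpace) => ω (-(t : ℝ))) W
  indep : IndepFun (fun (ω : PathSpace) (t : ℝ≥0) => ω (t : ℝ))
    (fun (ω : PathSpace) (t : ℝ≥0) => ω (-(t : ℝ))) W

/-- The real line `ℝ† = ℝ ∪ {†}` with a coffin state `†` (here `none`) adjoined. -/
abbrev RealCoffin : Type := Option ℝ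

namespace RealCoffin

/-- The `σ`-field on `ℝ†` generated by the Borel sets of `ℝ` and `{†}`. -/
instance : MeasurableSpace RealCoffin :=
  MeasurableSpace.generateFrom
    ({A : Set RealCoffin | ∃ E : Set ℝ, MeasurableSet E ∧ A = some '' E} ∪ {{none}})

/-- The effective range `[s]` of a sequence `s` in `ℝ†`: the real values that it takes. -/
def effectiveRange (s : ℕ → RealCoffin) : Set ℝ := {t : ℝ | ∃ i : ℕ, s i = some t}

end RealCoffin

/-- `S` is a measurable enumeration of the random set `M`: a sequence of `ℝ†`-valued random
variables, each measurable with respect to the `W`-completion of the Borel `σ`-field, with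
`M = [S]` almost surely. -/
def IsMeasurableEnumeration (W : Measure PathSpace) (M : PathSpace → Set ℝ)
    (S : ℕ → PathSpace → RealCoffin) : Prop :=
  (∀ i, NullMeasurable (S i) W) ∧
    ∀ᵐ ω ∂W, M ω = RealCoffin.effectiveRange (fun i => S i ω)

/-- A random countable set is a random set that admits a measurable enumeration. -/
def IsRandomCountableSet (W : Measure PathSpace) (M : PathSpace → Set ℝ) : Prop :=
  ∃ S : ℕ → PathSpace → RealCoffin, IsMeasurableEnumeration W M S

/-- Stationarity: for each `u`, almost surely `M = u + M(Δ_u)`. -/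
def IsStationaryRandomSet (W : Measure PathSpace) (M : PathSpace → Set ℝ) : Prop :=
  ∀ u : ℝ, ∀ᵐ ω ∂W, M ω = (fun x => u + x) '' M (PathSpace.levyShift u ω)

/-- Perfect stationarity: `M = u + M(Δ_u)` for all `u`, at every path. -/
def IsPerfectlyStationaryRandomSet (M : PathSpace → Set ℝ) : Prop :=
  ∀ (u : ℝ) (ω : PathSpace), M ω = (fun x => u + x) '' M (PathSpace.levyShift u ω)

/-- `M'` is a version of `M`: the event `{M = M'}` belongs to the completed `σ`-field and has
probability one. -/
def IsVersion (W : Measure PathSpace) (M' M : PathSpace → Set ℝ) : Prop :=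
  NullMeasurableSet {ω | M ω = M' ω} W ∧ W {ω | M ω = M' ω} = 1

/-! Replace M by an a.s. equal set D with a Borel enumeration, and let M'(ω) be the
Lebesgue-essential value in u of u + D(Δ_u ω), or ∅ if there is none. Since Δ is a flow, passing
from ω to Δ_v ω only translates u, and Lebesgue null sets are translation invariant; hence M' is
stationary at every path. Stationarity of M passes to D because each Δ_u preserves W
(`measurePreserving_levyShift`); Fubini then gives, for almost every ω, the equality u + D(Δ_u ω) =
D(ω) for almost every u, so M' = M a.s. (`ae_eq_perfectVersion`). For joint Borel measurability, an
essential value exists iff two independent choices of u agree almost everywhere, and equality of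
enumerated sets is a countable condition. -/

/-! ### Gaussian processes -/

/-- Two Gaussian processes with the same mean and covariance functions have the same
finite-dimensional distributions. -/
theorem ProbabilityTheory.IsGaussianProcess.map_restrict_eq_of_covariance_eq
    {T Ω : Type*} {mΩ : MeasurableSpace Ω} {P : Measure Ω} {X Y : T → Ω → ℝ}
    (hX : IsGaussianProcess X P) (hY : IsGaussianProcess Y P)
    (hmean : ∀ t, P[X t] = P[Y t]) (hcov : ∀ s t, cov[X s, X t; P] = cov[Y s, Y t; P])
    (I : Finset T) :
    P.map (fun ω ↦ I.restrict (X · ω)) = P.map (fun ω ↦ I.restrict (Y · ω)) := by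
  have mX : AEMeasurable (fun ω ↦ I.restrict (X · ω)) P :=
    aemeasurable_pi_lambda _ fun _ ↦ hX.aemeasurable _
  have mY : AEMeasurable (fun ω ↦ I.restrict (Y · ω)) P :=
    aemeasurable_pi_lambda _ fun _ ↦ hY.aemeasurable _
  -- A Gaussian law is determined by its mean and covariance form on an inner product space, hence
  -- the passage to the Euclidean norm.
  apply (MeasurableEquiv.toLp 2 (_ → ℝ)).map_measurableEquiv_injective
  rw [MeasurableEquiv.coe_toLp, ← PiLp.coe_symm_continuousLinearEquiv 2 ℝ]
  have gX := (hX.hasGaussianLaw I).isGaussian_map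
  have gY := (hY.hasGaussianLaw I).isGaussian_map
  apply IsGaussian.ext
  · rw [integral_map, integral_map, integral_map, integral_map]
    · simp only [id_eq]
      rw [ContinuousLinearEquiv.integral_comp_comm, ContinuousLinearEquiv.integral_comp_comm]
      congr 1
      ext i
      rw [eval_integral, eval_integral]
      · exact hmean i
      · exact fun _ ↦ (hY.hasGaussianLaw_eval _).integrable
      · exact fun _ ↦ (hX.hasGaussianLaw_eval _).integrable
    any_goals fun_prop
  · rw [← ContinuousLinearMap.toBilinForm_inj]
    -- By polarization the diagonal suffices.
    refine LinearMap.BilinForm.ext_of_isSymm isPosSemidef_covarianceBilin.isSymm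
      isPosSemidef_covarianceBilin.isSymm fun x ↦ ?_
    simp only [ContinuousLinearMap.toBilinForm_apply]
    rw [PiLp.coe_symm_continuousLinearEquiv, covarianceBilin_apply_pi, covarianceBilin_apply_pi]
    · congrm ∑ i, ∑ j, _ * ?_
      rw [covariance_map, covariance_map]
      · exact hcov i j
      any_goals exact Measurable.aestronglyMeasurable (by fun_prop)
      all_goals assumption
    · exact fun i ↦ (gY.hasGaussianLaw_id.eval i).memLp_two
    · exact fun i ↦ (gX.hasGaussianLaw_id.eval i).memLp_two

/-- Two independent Gaussian processes are jointly Gaussian. -/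
theorem ProbabilityTheory.IsGaussianProcess.sumElim {S T Ω : Type*} {mΩ : MeasurableSpace Ω}
    {P : Measure Ω} {X : S → Ω → ℝ} {Y : T → Ω → ℝ}
    (hX : IsGaussianProcess X P) (hY : IsGaussianProcess Y P)
    (h : IndepFun (fun ω s ↦ X s ω) (fun ω t ↦ Y t ω) P) :
    IsGaussianProcess (Sum.elim X Y) P where
  hasGaussianLaw I := by
    have hXY := IndepFun.hasGaussianLaw (hX.hasGaussianLaw I.toLeft) (hY.hasGaussianLaw I.toRight)
      (h.comp (φ := I.toLeft.restrict) (ψ := I.toRight.restrict)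
        (Finset.measurable_restrict _) (Finset.measurable_restrict _))
    let L : ((I.toLeft → ℝ) × (I.toRight → ℝ)) →L[ℝ] (I → ℝ) :=
      ContinuousLinearMap.pi fun i ↦ match i with
        | ⟨.inl s, hs⟩ => (ContinuousLinearMap.proj (R := ℝ) (φ := fun _ : I.toLeft ↦ ℝ)
            ⟨s, Finset.mem_toLeft.2 hs⟩).comp (ContinuousLinearMap.fst ℝ _ _)
        | ⟨.inr t, ht⟩ => (ContinuousLinearMap.proj (R := ℝ) (φ := fun _ : I.toRight ↦ ℝ)
            ⟨t, Finset.mem_toRight.2 ht⟩).comp (ContinuousLinearMap.snd ℝ _ _)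
    have hL : (fun ω ↦ I.restrict (Sum.elim X Y · ω))
        = L ∘ fun ω ↦ (I.toLeft.restrict (X · ω), I.toRight.restrict (Y · ω)) := by
      ext ω i
      obtain ⟨i | i, hi⟩ := i <;> rfl
    rw [hL]
    exact hXY.map L

/-! ### Path space and Lévy shifts -/

namespace PathSpace

@[ext] theorem ext {ω ω' : PathSpace} (h : ∀ t, ω t = ω' t) : ω = ω' :=
  Subtype.ext (ContinuousMap.ext h)

@[simp] theorem apply_zero (ω : PathSpace) : ω 0 = 0 := ω.2

@[simp] theorem levyShift_apply (u : ℝ) (ω : PathSpace) (t : ℝ) :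
    levyShift u ω t = ω (u + t) - ω u := rfl

theorem levyShift_levyShift (u v : ℝ) (ω : PathSpace) :
    levyShift u (levyShift v ω) = levyShift (v + u) ω := by
  ext t
  simp [add_assoc]

@[simp] theorem levyShift_zero (ω : PathSpace) : levyShift 0 ω = ω := by
  ext t
  simp

instance : PolishSpace PathSpace :=
  (isClosed_singleton.preimage (continuous_eval_const (F := C(ℝ, ℝ)) (0 : ℝ)) :
    IsClosed {ω : C(ℝ, ℝ) | ω 0 = 0}).polishSpace

theorem continuous_eval : Continuous fun p : PathSpace × ℝ ↦ p.1 p.2 :=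
  ContinuousEval.continuous_eval.comp
    ((continuous_subtype_val.comp continuous_fst).prodMk continuous_snd)

theorem continuous_levyShift : Continuous fun p : PathSpace × ℝ ↦ levyShift p.2 p.1 := by
  refine Continuous.subtype_mk (ContinuousMap.continuous_of_continuous_uncurry _ ?_) _
  exact (continuous_eval.comp (f := fun q : (PathSpace × ℝ) × ℝ ↦ (q.1.1, q.1.2 + q.2))
    (by fun_prop)).sub (continuous_eval.comp continuous_fst)

theorem measurable_levyShift : Measurable fun p : PathSpace × ℝ ↦ levyShift p.2 p.1 :=
  continuous_levyShift.measurable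

theorem measurable_eval (t : ℝ) : Measurable fun ω : PathSpace ↦ ω t :=
  (continuous_eval.comp (continuous_id.prodMk continuous_const)).measurable

/-- A path is determined, as a Borel object, by its values at rational times. -/
theorem measurableEmbedding_eval_rat :
    MeasurableEmbedding fun (ω : PathSpace) (q : ℚ) ↦ ω (q : ℝ) := by
  have hm : Measurable fun (ω : PathSpace) (q : ℚ) ↦ ω (q : ℝ) :=
    measurable_pi_lambda _ fun q ↦ measurable_eval q
  -- Lusin–Souslin: an injective Borel map on a Polish space is an embedding.
  refine hm.measurableEmbedding fun ω ω' h ↦ ?_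
  refine Subtype.ext (DFunLike.coe_injective ?_)
  exact Rat.denseRange_cast.equalizer ω.1.continuous ω'.1.continuous h

end PathSpace

/-! ### Shift invariance of Wiener measure -/

namespace IsTwoSidedWienerMeasure

open PathSpace

variable {W : Measure PathSpace}

theorem isGaussianProcess (hW : IsTwoSidedWienerMeasure W) :
    IsGaussianProcess (fun (t : ℝ) (ω : PathSpace) ↦ ω t) W := by
  have h := hW.forward.isGaussianProcess.sumElim hW.backward.isGaussianProcess hW.indep
  refine (h.comp_right
    (fun t : ℝ ↦ if 0 ≤ t then .inl t.toNNReal else .inr (-t).toNNReal)).congr fun t ↦ ?_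
  refine .of_forall fun ω ↦ ?_
  by_cases ht : 0 ≤ t
  · simp [ht]
  · simp [ht, (not_le.1 ht).le]

theorem isProbabilityMeasure (hW : IsTwoSidedWienerMeasure W) : IsProbabilityMeasure W :=
  hW.isGaussianProcess.isProbabilityMeasure

theorem memLp_eval (hW : IsTwoSidedWienerMeasure W) (t : ℝ) :
    MemLp (fun ω : PathSpace ↦ ω t) 2 W :=
  (hW.isGaussianProcess.hasGaussianLaw_eval t).memLp_two

theorem integral_eval (hW : IsTwoSidedWienerMeasure W) (t : ℝ) : ∫ ω : PathSpace, ω t ∂W = 0 := by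
  obtain ht | ht := le_total 0 t
  · simpa [ht] using hW.forward.integral_eval t.toNNReal
  · simpa [ht] using hW.backward.integral_eval (-t).toNNReal

theorem covariance_eval (hW : IsTwoSidedWienerMeasure W) (s t : ℝ) :
    cov[fun ω : PathSpace ↦ ω s, fun ω ↦ ω t; W] = (|s| + |t| - |s - t|) / 2 := by
  -- For times of opposite sign, |s - t| = |s| + |t|, in accordance with independence of the two
  -- halves.
  have hmixed {s t : ℝ} (hs : 0 ≤ s) (ht : t ≤ 0) :
      cov[fun ω : PathSpace ↦ ω s, fun ω ↦ ω t; W] = 0 := by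
    have := (hW.indep.comp (measurable_pi_apply s.toNNReal)
      (measurable_pi_apply (-t).toNNReal)).covariance_eq_zero
      (by simpa [Function.comp_def] using hW.memLp_eval _)
      (by simpa [Function.comp_def] using hW.memLp_eval _)
    simpa [Function.comp_def, hs, ht] using this
  obtain hs | hs := le_total 0 s <;> obtain ht | ht := le_total 0 t
  · have := hW.forward.covariance_eval s.toNNReal t.toNNReal
    simp only [Real.coe_toNNReal, hs, ht, NNReal.coe_min] at this
    rw [this, min_def]
    grind
  · rw [hmixed hs ht]
    grind
  · rw [covariance_comm, hmixed ht hs]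
    grind
  · have := hW.backward.covariance_eval (-s).toNNReal (-t).toNNReal
    simp only [Real.coe_toNNReal, Left.nonneg_neg_iff, hs, ht, NNReal.coe_min, neg_neg] at this
    rw [this, min_def]
    grind

/-- The Lévy shifts preserve the two-sided Wiener measure. -/
theorem measurePreserving_levyShift (hW : IsTwoSidedWienerMeasure W) (u : ℝ) :
    MeasurePreserving (levyShift u) W W := by
  have := hW.isProbabilityMeasure
  have hm : Measurable (levyShift u) :=
    measurable_levyShift.comp (measurable_id.prodMk measurable_const)
  refine ⟨hm, ?_⟩
  have hX : IsGaussianProcess (fun (q : ℚ) (ω : PathSpace) ↦ ω (q : ℝ)) W :=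
    hW.isGaussianProcess.comp_right _
  have hY : IsGaussianProcess (fun (q : ℚ) (ω : PathSpace) ↦ ω (u + q) - ω u) W :=
    (hW.isGaussianProcess.shift u).comp_right (fun q : ℚ ↦ (q : ℝ))
  have hlaw : W.map (fun (ω : PathSpace) (q : ℚ) ↦ ω (u + q) - ω u)
      = W.map (fun (ω : PathSpace) (q : ℚ) ↦ ω (q : ℝ)) := by
    refine (map_eq_iff_forall_finset_map_restrict_eq
      (X := fun (q : ℚ) (ω : PathSpace) ↦ ω (u + q) - ω u)
      (Y := fun (q : ℚ) (ω : PathSpace) ↦ ω (q : ℝ)) ?_ ?_).2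
      fun I ↦ hY.map_restrict_eq_of_covariance_eq hX (fun q ↦ ?_) (fun p q ↦ ?_) I
    · exact aemeasurable_pi_lambda _ fun q ↦ hY.aemeasurable q
    · exact aemeasurable_pi_lambda _ fun q ↦ hX.aemeasurable q
    · rw [integral_sub ((hW.memLp_eval _).integrable one_le_two)
        ((hW.memLp_eval _).integrable one_le_two)]
      simp [hW.integral_eval]
    · rw [covariance_fun_sub_fun_sub (hW.memLp_eval _) (hW.memLp_eval _) (hW.memLp_eval _)
        (hW.memLp_eval _)]
      simp only [hW.covariance_eval]
      rw [show u + p - (u + q) = (p - q : ℝ) by ring, show u + p - u = (p : ℝ) by ring,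
        show u - (u + q) = (-q : ℝ) by ring, sub_self, abs_zero, abs_neg]
      ring
  have hι := measurableEmbedding_eval_rat
  -- A measure is recovered from its image under an embedding by pulling back.
  rw [← hι.comap_map (W.map (levyShift u)), Measure.map_map hι.measurable hm]
  exact (congrArg _ hlaw).trans (hι.comap_map W)

end IsTwoSidedWienerMeasure

/-! ### Borel enumerations -/

theorem RealCoffin.measurable_getD : Measurable fun x : RealCoffin ↦ x.getD 0 := by
  intro E hE
  have hsome : MeasurableSet (some '' E : Set RealCoffin) :=
    MeasurableSpace.measurableSet_generateFrom (.inl ⟨E, hE, rfl⟩)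
  have hnone : MeasurableSet ({none} : Set RealCoffin) :=
    MeasurableSpace.measurableSet_generateFrom (.inr rfl)
  have : (fun x : RealCoffin ↦ x.getD 0) ⁻¹' E
      = some '' E ∪ ({none} ∩ {_x : RealCoffin | (0 : ℝ) ∈ E}) := by
    ext x
    cases x <;> simp
  rw [this]
  exact hsome.union (hnone.inter (.const _))

theorem RealCoffin.measurableSet_ne_none : MeasurableSet {x : RealCoffin | x ≠ none} :=
  MeasurableSet.compl (MeasurableSpace.measurableSet_generateFrom (.inr rfl))

/-- The random countable set `{f i ω : i ∈ ℕ, ω ∈ A i}`. -/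
def enumeratedSet {Ω : Type*} (A : ℕ → Set Ω) (f : ℕ → Ω → ℝ) (ω : Ω) : Set ℝ :=
  {t | ∃ i, ω ∈ A i ∧ f i ω = t}

theorem countable_enumeratedSet {Ω : Type*} (A : ℕ → Set Ω) (f : ℕ → Ω → ℝ) (ω : Ω) :
    (enumeratedSet A f ω).Countable :=
  (Set.countable_range fun i ↦ f i ω).mono <| by
    rintro _ ⟨i, _, rfl⟩
    exact ⟨i, rfl⟩

/-- Every random countable set is almost surely equal to one enumerated by Borel functions. -/
theorem IsRandomCountableSet.exists_ae_eq_enumeratedSet {W : Measure PathSpace}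
    {M : PathSpace → Set ℝ} (hM : IsRandomCountableSet W M) :
    ∃ (A : ℕ → Set PathSpace) (f : ℕ → PathSpace → ℝ), (∀ i, MeasurableSet (A i)) ∧
      (∀ i, Measurable (f i)) ∧ M =ᵐ[W] enumeratedSet A f := by
  obtain ⟨S, hS, hMS⟩ := hM
  have hA i : NullMeasurableSet {ω | S i ω ≠ none} W := hS i RealCoffin.measurableSet_ne_none
  have hf i : AEMeasurable (fun ω ↦ (S i ω).getD 0) W :=
    NullMeasurable.aemeasurable fun E hE ↦ hS i (RealCoffin.measurable_getD hE)
  choose A _ hAm hAS using fun i ↦ (hA i).exists_measurable_superset_ae_eq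
  refine ⟨A, fun i ↦ (hf i).mk, hAm, fun i ↦ (hf i).measurable_mk, ?_⟩
  filter_upwards [hMS, ae_all_iff.2 hAS, ae_all_iff.2 fun i ↦ (hf i).ae_eq_mk] with ω h1 h2 h3
  rw [h1]
  ext t
  refine exists_congr fun i ↦ ?_
  have h2i : ω ∈ A i ↔ S i ω ≠ none := iff_of_eq (h2 i)
  beta_reduce
  rw [h2i, ← h3 i]
  -- The default value 0 at † never enters the set, since then ω ∉ A i.
  cases S i ω <;> simp

/-! ### The perfect version -/

open PathSpace

/-- The translate `u + D (Δ_u ω)`, viewed at the path `ω`. -/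
def shiftedSet (D : PathSpace → Set ℝ) (u : ℝ) (ω : PathSpace) : Set ℝ :=
  {t | t - u ∈ D (levyShift u ω)}

/-- The common value of `u + D (Δ_u ω)` for Lebesgue almost every `u`, and the empty set if there
is no such value. -/
def perfectVersion (D : PathSpace → Set ℝ) (ω : PathSpace) : Set ℝ :=
  {t | ∃ C : Set ℝ, (∀ᵐ u, shiftedSet D u ω = C) ∧ t ∈ C}

section perfectVersion

variable {D : PathSpace → Set ℝ}

theorem image_add_eq_shiftedSet (D : PathSpace → Set ℝ) (u : ℝ) (ω : PathSpace) :
    (fun x ↦ u + x) '' D (levyShift u ω) = shiftedSet D u ω := by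
  ext t
  simp [shiftedSet, neg_add_eq_sub]

/-- Two essential values agree, because two conull sets of u intersect. -/
theorem perfectVersion_eq {C : Set ℝ} {ω : PathSpace} (h : ∀ᵐ u, shiftedSet D u ω = C) :
    perfectVersion D ω = C := by
  ext t
  refine ⟨fun ⟨C', hC', ht⟩ ↦ ?_, fun ht ↦ ⟨C, h, ht⟩⟩
  obtain ⟨u, hu, hu'⟩ := (h.and hC').exists
  rwa [← hu, hu']

theorem countable_perfectVersion (hD : ∀ ω, (D ω).Countable) (ω : PathSpace) :
    (perfectVersion D ω).Countable := by
  by_cases h : ∃ C, ∀ᵐ u, shiftedSet D u ω = C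
  · obtain ⟨C, hC⟩ := h
    obtain ⟨u, rfl⟩ := hC.exists
    rw [perfectVersion_eq hC, ← image_add_eq_shiftedSet]
    exact (hD _).image _
  · have : perfectVersion D ω = ∅ :=
      Set.eq_empty_of_forall_notMem fun t ⟨C, hC, _⟩ ↦ h ⟨C, hC⟩
    simp [this]

/-- Shifting the path by v reparametrizes u as v + u, which preserves Lebesgue null sets. -/
theorem sub_mem_perfectVersion_levyShift (v : ℝ) {ω : PathSpace} {t : ℝ}
    (ht : t ∈ perfectVersion D ω) : t - v ∈ perfectVersion D (levyShift v ω) := by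
  obtain ⟨C, hC, htC⟩ := ht
  refine ⟨{s | s + v ∈ C}, ?_, by simpa using htC⟩
  filter_upwards [(measurePreserving_add_left volume v).quasiMeasurePreserving.ae hC] with u hu
  rw [← hu]
  ext s
  simp only [shiftedSet, levyShift_levyShift, Set.mem_ofPred_eq]
  rw [show s + v - (v + u) = s - u by ring]

theorem isPerfectlyStationaryRandomSet_perfectVersion (D : PathSpace → Set ℝ) :
    IsPerfectlyStationaryRandomSet (perfectVersion D) := by
  intro u ω
  ext t
  refine ⟨fun ht ↦ ⟨t - u, sub_mem_perfectVersion_levyShift u ht, by simp⟩, ?_⟩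
  rintro ⟨s, hs, rfl⟩
  have := sub_mem_perfectVersion_levyShift (-u) hs
  rwa [levyShift_levyShift, add_neg_cancel, levyShift_zero, sub_neg_eq_add, add_comm] at this

/-- This trades the quantifier over all values c, unusable for measurability when c is a set, for a
condition on pairs. Conversely, by Fubini, some g x serves as c. -/
theorem exists_ae_eq_const_iff {α β : Type*} [MeasurableSpace α] {μ : Measure α} [SFinite μ]
    [NeZero μ] {g : α → β} :
    (∃ c, ∀ᵐ x ∂μ, g x = c) ↔ ∀ᵐ p ∂μ.prod μ, g p.1 = g p.2 := by
  refine ⟨fun ⟨c, hc⟩ ↦ ?_, fun h ↦ ?_⟩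
  · filter_upwards [Measure.quasiMeasurePreserving_fst.ae hc,
      Measure.quasiMeasurePreserving_snd.ae hc] with p h1 h2
    rw [h1, h2]
  · obtain ⟨x, hx⟩ := (Measure.ae_ae_of_ae_prod h).exists
    exact ⟨g x, hx.mono fun y hy ↦ hy.symm⟩

theorem measurableSet_forall_ae {α β : Type*} [MeasurableSpace α] [MeasurableSpace β]
    {ν : Measure β} [SFinite ν] {s : Set (α × β)} (hs : MeasurableSet s) :
    MeasurableSet {a | ∀ᵐ b ∂ν, (a, b) ∈ s} :=
  measurable_measure_prodMk_left hs.compl (measurableSet_singleton 0)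

variable {A : ℕ → Set PathSpace} {f : ℕ → PathSpace → ℝ}

theorem measurableSet_mem_shiftedSet (hA : ∀ i, MeasurableSet (A i)) (hf : ∀ i, Measurable (f i)) :
    MeasurableSet {p : (PathSpace × ℝ) × ℝ |
      p.1.2 ∈ shiftedSet (enumeratedSet A f) p.2 p.1.1} := by
  have hs : Measurable fun p : (PathSpace × ℝ) × ℝ ↦ levyShift p.2 p.1.1 :=
    measurable_levyShift.comp (by fun_prop : Measurable fun p : (PathSpace × ℝ) × ℝ ↦ (p.1.1, p.2))
  have : {p : (PathSpace × ℝ) × ℝ | p.1.2 ∈ shiftedSet (enumeratedSet A f) p.2 p.1.1} =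
      ⋃ i, ({p | levyShift p.2 p.1.1 ∈ A i} ∩
        {p | f i (levyShift p.2 p.1.1) = p.1.2 - p.2}) := by
    ext p
    simp [shiftedSet, enumeratedSet]
  rw [this]
  exact .iUnion fun i ↦ (hs (hA i)).inter
    (measurableSet_eq_fun ((hf i).comp hs)
      (by fun_prop : Measurable fun p : (PathSpace × ℝ) × ℝ ↦ p.1.2 - p.2))

theorem mem_shiftedSet_enumeratedSet {u t : ℝ} {ω : PathSpace} :
    t ∈ shiftedSet (enumeratedSet A f) u ω ↔
      ∃ i, levyShift u ω ∈ A i ∧ f i (levyShift u ω) + u = t := by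
  simp [shiftedSet, enumeratedSet, eq_sub_iff_add_eq]

/-- Inclusion need only be tested on the enumerated points, so it is a countable combination of
Borel conditions. -/
theorem measurableSet_shiftedSet_subset (hA : ∀ i, MeasurableSet (A i))
    (hf : ∀ i, Measurable (f i)) :
    MeasurableSet {p : PathSpace × ℝ × ℝ | shiftedSet (enumeratedSet A f) p.2.1 p.1 ⊆
      shiftedSet (enumeratedSet A f) p.2.2 p.1} := by
  have h1 : Measurable fun p : PathSpace × ℝ × ℝ ↦ levyShift p.2.1 p.1 :=
    measurable_levyShift.comp (by fun_prop : Measurable fun p : PathSpace × ℝ × ℝ ↦ (p.1, p.2.1))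
  have h2 : Measurable fun p : PathSpace × ℝ × ℝ ↦ levyShift p.2.2 p.1 :=
    measurable_levyShift.comp (by fun_prop : Measurable fun p : PathSpace × ℝ × ℝ ↦ (p.1, p.2.2))
  have : {p : PathSpace × ℝ × ℝ | shiftedSet (enumeratedSet A f) p.2.1 p.1 ⊆
      shiftedSet (enumeratedSet A f) p.2.2 p.1} =
      ⋂ i, ({p | levyShift p.2.1 p.1 ∈ A i}ᶜ ∪ ⋃ j, ({p | levyShift p.2.2 p.1 ∈ A j} ∩
        {p | f j (levyShift p.2.2 p.1) + p.2.2 = f i (levyShift p.2.1 p.1) + p.2.1})) := by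
    ext p
    simp only [Set.subset_def, mem_shiftedSet_enumeratedSet, Set.mem_ofPred_eq, Set.mem_iInter,
      Set.mem_union, Set.mem_compl_iff, Set.mem_iUnion, Set.mem_inter_iff, ← imp_iff_not_or,
      forall_exists_index, and_imp]
    exact ⟨fun h i hi ↦ h _ i hi rfl, fun h t i hi ht ↦ ht ▸ h i hi⟩
  rw [this]
  refine .iInter fun i ↦ (h1 (hA i)).compl.union (.iUnion fun j ↦ (h2 (hA j)).inter ?_)
  have hi := (hf i).comp h1
  have hj := (hf j).comp h2
  exact measurableSet_eq_fun (hj.add (by fun_prop)) (hi.add (by fun_prop))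

theorem measurableSet_shiftedSet_eq (hA : ∀ i, MeasurableSet (A i))
    (hf : ∀ i, Measurable (f i)) :
    MeasurableSet {p : PathSpace × ℝ × ℝ | shiftedSet (enumeratedSet A f) p.2.1 p.1 =
      shiftedSet (enumeratedSet A f) p.2.2 p.1} := by
  have hsub := measurableSet_shiftedSet_subset hA hf
  have hswap : Measurable fun p : PathSpace × ℝ × ℝ ↦ (p.1, p.2.2, p.2.1) := by fun_prop
  simp only [Set.Subset.antisymm_iff]
  exact hsub.inter (hswap hsub)

theorem measurableSet_mem_perfectVersion (hA : ∀ i, MeasurableSet (A i))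
    (hf : ∀ i, Measurable (f i)) :
    MeasurableSet {p : PathSpace × ℝ | p.2 ∈ perfectVersion (enumeratedSet A f) p.1} := by
  have hgood := measurableSet_forall_ae (ν := (volume : Measure ℝ).prod volume)
    (measurableSet_shiftedSet_eq hA hf)
  have hmem := measurableSet_forall_ae (ν := (volume : Measure ℝ))
    (measurableSet_mem_shiftedSet hA hf)
  -- Once an essential value exists, belonging to it means belonging to almost every translate.
  convert (measurable_fst hgood).inter hmem using 1
  ext ⟨ω, t⟩
  have hgood_iff := exists_ae_eq_const_iff (μ := (volume : Measure ℝ))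
    (g := fun u ↦ shiftedSet (enumeratedSet A f) u ω)
  simp only [Set.mem_ofPred_eq, Set.mem_inter_iff, Set.mem_preimage, ← hgood_iff]
  constructor
  · rintro ⟨C, hC, ht⟩
    exact ⟨⟨C, hC⟩, hC.mono fun u hu ↦ hu ▸ ht⟩
  · rintro ⟨⟨C, hC⟩, ht⟩
    obtain ⟨u, hu, hu'⟩ := (hC.and ht).exists
    exact ⟨C, hC, hu ▸ hu'⟩

/-- A stationary random set with a Borel enumeration agrees almost surely with its perfect
version. -/
theorem ae_eq_perfectVersion {W : Measure PathSpace} (hW : IsTwoSidedWienerMeasure W)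
    {M : PathSpace → Set ℝ} (hstat : IsStationaryRandomSet W M)
    (hA : ∀ i, MeasurableSet (A i)) (hf : ∀ i, Measurable (f i))
    (hM : M =ᵐ[W] enumeratedSet A f) :
    M =ᵐ[W] perfectVersion (enumeratedSet A f) := by
  have := hW.isProbabilityMeasure
  have hfix (u : ℝ) : ∀ᵐ ω ∂W, shiftedSet (enumeratedSet A f) u ω
      = shiftedSet (enumeratedSet A f) 0 ω := by
    filter_upwards [hstat u, hM,
      -- Shift invariance gives M = D at Δ_u ω as well as at ω.
      (hW.measurePreserving_levyShift u).quasiMeasurePreserving.ae hM] with ω h1 h2 h3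
    rw [← image_add_eq_shiftedSet, ← h3, ← h1, h2]
    simp [shiftedSet]
  have hmeas : MeasurableSet {p : ℝ × PathSpace | shiftedSet (enumeratedSet A f) p.1 p.2
      = shiftedSet (enumeratedSet A f) 0 p.2} :=
    (by fun_prop : Measurable fun p : ℝ × PathSpace ↦ (p.2, p.1, (0 : ℝ)))
      (measurableSet_shiftedSet_eq hA hf)
  -- Fubini turns "for every u, almost surely" into "almost surely, for almost every u".
  have hae := (Measure.ae_ae_comm (μ := (volume : Measure ℝ)) (ν := W) hmeas).1 (.of_forall hfix)
  filter_upwards [hM, hae] with ω h1 h2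
  rw [perfectVersion_eq h2, h1]
  simp [shiftedSet]

end perfectVersion

theorem proposition3p10 (W : Measure PathSpace) (hW : IsTwoSidedWienerMeasure W)
    (M : PathSpace → Set ℝ) (hM : IsRandomCountableSet W M) (hstat : IsStationaryRandomSet W M) :
    ∃ M' : PathSpace → Set ℝ,
      IsVersion W M' M ∧
      IsRandomCountableSet W M' ∧
      IsPerfectlyStationaryRandomSet M' ∧
      (∀ ω : PathSpace, (M' ω).Countable) ∧
      MeasurableSet {p : PathSpace × ℝ | p.2 ∈ M' p.1} := by
  have := hW.isProbabilityMeasure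
  obtain ⟨A, f, hA, hf, hMD⟩ := hM.exists_ae_eq_enumeratedSet
  have hae := ae_eq_perfectVersion hW hstat hA hf hMD
  refine ⟨perfectVersion (enumeratedSet A f), ⟨?_, ?_⟩, ?_,
    isPerfectlyStationaryRandomSet_perfectVersion _,
    countable_perfectVersion (countable_enumeratedSet A f),
    measurableSet_mem_perfectVersion hA hf⟩
  · exact NullMeasurableSet.congr .univ (Filter.eventuallyEq_univ.2 hae).symm
  · rw [measure_congr (Filter.eventuallyEq_univ.2 hae), measure_univ]
  -- An enumeration need only be correct almost surely, so that of M serves again.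
  · obtain ⟨S, hS, hMS⟩ := hM
    refine ⟨S, hS, ?_⟩
    filter_upwards [hae, hMS] with ω h1 h2
    rw [← h1, h2]
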